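/- Let $\Pi$ be the set of all cyclic orderings of the seven elements $0,1,\dots,6$, so that $|\Pi| = 6! = 720$. For $\rho\in\Pi$ let $\rho^{-1}$ denote the reversed cyclic ordering. For $\rho_1,\rho_2\in\Pi$ let $Q(\rho_1,\rho_2)$ be the minimum number of interchanges of (cyclically) adjacent elements of $\rho_1$ required to produce $\rho_2^{-1}$, and let $Q$ be the $720\times 720$ matrix with entries $Q(\rho_1,\rho_2)$. Then the minimum of $x^T Q x$ over the standard simplex $\{x\in\mathbb{R}^{720} : x\ge 0,\ e^T x=1\}$, where $e$ is the all-ones vector, is attained and satisfies $$\min\left\{x^T Q x \;:\; x\in\mathbb{R}_+^{720},\ e^T x=1\right\}\ \ge\ 4.3593 .$$ -/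

import Mathlib

open Equiv Matrix

/-- A cyclic ordering of the `m` elements `0, …, m - 1`, encoded by its successor map: a permutation
all of whose points lie in one single cycle.  The cyclic ordering `(a₀ a₁ … aₘ₋₁)` is the permutation
`a₀ ↦ a₁ ↦ … ↦ aₘ₋₁ ↦ a₀`. There are `(m - 1)!` of them for `m ≥ 1`. -/
abbrev CyclicOrdering (m : ℕ) : Type :=
  {σ : Perm (Fin m) // ∀ a b, σ.SameCycle a b}

namespace CyclicOrdering

variable {m : ℕ}

/-- The reversed cyclic ordering `ρ⁻¹`. -/
def reverse (ρ : CyclicOrdering m) : CyclicOrdering m :=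
  ⟨ρ.1⁻¹, fun a b => (ρ.2 a b).inv⟩

/-- `ρ'` arises from `ρ` by interchanging two adjacent elements, namely some element `a` and its
successor `b = ρ a`: from `(… a b …)` to `(… b a …)`. Renaming the elements of a cyclic ordering by
a permutation is conjugation by that permutation. -/
def IsInterchange (ρ ρ' : CyclicOrdering m) : Prop :=
  ∃ a : Fin m, ρ'.1 = swap a (ρ.1 a) * ρ.1 * (swap a (ρ.1 a))⁻¹

/-- `ρ'` can be produced from `ρ` by a sequence of exactly `k` interchanges of adjacent elements. -/
def ReachableIn (k : ℕ) (ρ ρ' : CyclicOrdering m) : Prop :=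
  ∃ path : ℕ → CyclicOrdering m, path 0 = ρ ∧ path k = ρ' ∧
    ∀ i < k, IsInterchange (path i) (path (i + 1))

/-- The least number of interchanges of adjacent elements that produce `ρ'` from `ρ`
(the set is never empty, see `exists_reachableIn`). -/
noncomputable def interchangeDist (ρ ρ' : CyclicOrdering m) : ℕ :=
  sInf {k | ReachableIn k ρ ρ'}

theorem ReachableIn.succ {k : ℕ} {ρ ρ' ρ'' : CyclicOrdering m} (h : ReachableIn k ρ ρ')
    (h' : IsInterchange ρ' ρ'') : ReachableIn (k + 1) ρ ρ'' := by
  obtain ⟨p, h0, hk, hp⟩ := h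
  refine ⟨fun i => if i ≤ k then p i else ρ'', by simp [h0], by simp, fun i hi => ?_⟩
  rcases Nat.lt_succ_iff_lt_or_eq.1 hi with hi | rfl
  · have h1 : i ≤ k := hi.le
    have h2 : i + 1 ≤ k := hi
    simpa [h1, h2] using hp i hi
  · simpa [hk] using h'

/-- Any cyclic ordering can be produced from any other one by interchanges of adjacent elements. -/
theorem exists_reachableIn (ρ ρ' : CyclicOrdering m) : ∃ k, ReachableIn k ρ ρ' := by
  rcases Nat.lt_or_ge m 2 with hm | hm
  · have : Subsingleton (Fin m) := Fin.subsingleton_iff_le_one.2 (by omega)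
    exact ⟨0, fun _ => ρ, rfl, Subsingleton.elim _ _, by simp⟩
  obtain ⟨n, rfl⟩ : ∃ n, m = n + 2 := ⟨m - 2, by omega⟩
  have hconj (σ : CyclicOrdering (n + 2)) : ∃ g, g * finRotate (n + 2) * g⁻¹ = σ.1 := by
    have hfix (a : Fin (n + 2)) : σ.1 a ≠ a := fun h => by
      obtain ⟨b, hb⟩ := exists_ne a
      exact hb ((σ.2 a b).eq_of_left h).symm
    have hc : σ.1.IsCycle := ⟨0, hfix 0, fun b _ => σ.2 0 b⟩
    refine isConj_iff.1 (isCycle_finRotate.isConj hc ?_)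
    rw [support_finRotate]
    congr 1
    ext a
    simp [hfix a]
  obtain ⟨g, hg⟩ := hconj ρ
  obtain ⟨g', hg'⟩ := hconj ρ'
  have key (w : Perm (Fin (n + 2))) : ∀ ρ'' : CyclicOrdering (n + 2),
      ρ''.1 = (g * w) * finRotate (n + 2) * (g * w)⁻¹ → ∃ k, ReachableIn k ρ ρ'' := by
    have hw : w ∈ Submonoid.closure (Set.range fun i : Fin (n + 1) => swap i.castSucc i.succ) := by
      rw [Perm.mclosure_swap_castSucc_succ]
      trivial
    induction hw using Submonoid.closure_induction_right with
    | one =>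
      intro ρ'' h
      refine ⟨0, fun _ => ρ, rfl, ?_, by simp⟩
      exact Subtype.ext (by rw [h, ← hg, mul_one])
    | mul_right w _ s hs ih =>
      intro ρ'' h
      obtain ⟨i, rfl⟩ := hs
      have h1 : ∀ a b, ((g * w) * finRotate (n + 2) * (g * w)⁻¹).SameCycle a b := fun a b => by
        rw [Perm.sameCycle_conj]
        have := (ρ.2 (g ((g * w)⁻¹ a)) (g ((g * w)⁻¹ b)))
        rw [← hg, Perm.sameCycle_conj] at this
        simpa using this
      obtain ⟨k, hk⟩ := ih ⟨_, h1⟩ rfl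
      refine ⟨k + 1, hk.succ ⟨(g * w) i.castSucc, ?_⟩⟩
      have h2 : ((g * w) * finRotate (n + 2) * (g * w)⁻¹) ((g * w) i.castSucc)
          = (g * w) i.succ := by
        simp
      have h3 : swap ((g * w) i.castSucc) ((g * w) i.succ)
          = (g * w) * swap i.castSucc i.succ * (g * w)⁻¹ := swap_apply_apply _ _ _
      change ρ''.1 = swap _ (((g * w) * finRotate (n + 2) * (g * w)⁻¹) ((g * w) i.castSucc)) *
        ((g * w) * finRotate (n + 2) * (g * w)⁻¹) * _⁻¹
      rw [h]
      simp only [h2, h3]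
      group
  exact key (g⁻¹ * g') ρ' (by rw [← hg']; group)

end CyclicOrdering

/-- The matrix `Q` indexed by the cyclic orderings of `m` elements: `Q ρ₁ ρ₂` is the minimum number
of interchanges of adjacent elements of `ρ₁` required to produce `ρ₂⁻¹`. -/
noncomputable def crossingMatrix (m : ℕ) : Matrix (CyclicOrdering m) (CyclicOrdering m) ℝ :=
  Matrix.of fun ρ₁ ρ₂ => (ρ₁.interchangeDist ρ₂.reverse : ℝ)

/-! Renaming the elements `1, …, 6` acts simply transitively on the cyclic orderings of seven
elements and preserves interchanges. Identifying the orderings with the group `G = Perm (Fin 6)`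
thus turns the entry of `Q` at `(g, h)` into a function of `g⁻¹ * h`, namely the distance `d (g⁻¹ *
h * r)` from the standard ordering, with `r` the reversal.

The lower bound comes from a dual certificate: a weight `w` on `G` whose correlation `A h = ∑ g, w g
* w (h * g)` satisfies `A h ≤ N * d (h * r) + T` for every `h`. The matrix with entries `A (g⁻¹ *
h)` is a Gram matrix, and for `x` in the simplex its quadratic form is `∑ k, (∑ h, x h * w (h⁻¹ *
k)) ^ 2`. The inner sums add up to `∑ w` whatever `x` is, so Cauchy–Schwarz bounds the form below by
`(∑ w) ^ 2 / 720`. Since `x ≥ 0`, the entrywise inequality then gives `xᵀQx ≥ ((∑ w) ^ 2 / 720 - T)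
/ N`. This is `sq_sum_div_card_le_of_correlation_le`.

Only lower bounds on the entries of `Q` are needed. A table `dist` that vanishes at the identity and
grows by at most one per interchange provides them (`le_interchangeDist_ofPerm`); its exactness
plays no role. The finite checks (the 720 correlation inequalities, the total weight, the growth of
`dist`) are kernel computations on decision trees, linked to sums over `G` by `sum_eval_mul_eval_le`
and `sum_perms`. -/

namespace CyclicOrdering

/-! ### Cyclic orderings of seven elements as elements of `Perm (Fin 6)` -/

/-- The permutation of `Fin 7` that fixes `0` and acts as `h` on the other elements. -/
def fixZero (h : Perm (Fin 6)) : Perm (Fin 7) :=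
  Perm.decomposeFin.symm (0, h)

@[simp] theorem fixZero_zero (h : Perm (Fin 6)) : fixZero h 0 = 0 := by
  simp [fixZero]

@[simp] theorem fixZero_succ (h : Perm (Fin 6)) (i : Fin 6) :
    fixZero h i.succ = (h i).succ := by
  simp [fixZero]

theorem fixZero_mul (g h : Perm (Fin 6)) : fixZero (g * h) = fixZero g * fixZero h := by
  ext i
  refine Fin.cases ?_ (fun i => ?_) i <;> simp

theorem fixZero_injective : Function.Injective fixZero := fun g h hgh => by
  simpa [fixZero] using hgh

theorem exists_fixZero {g : Perm (Fin 7)} (hg : g 0 = 0) : ∃ h, fixZero h = g := by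
  obtain ⟨⟨p, h⟩, rfl⟩ := Perm.decomposeFin.symm.surjective g
  obtain rfl : p = 0 := by simpa using hg
  exact ⟨h, rfl⟩

theorem finRotate_pow_zero (k : Fin 7) : (finRotate 7 ^ (k : ℕ)) 0 = k := by
  revert k
  decide

theorem sameCycle_finRotate (a b : Fin 7) : (finRotate 7).SameCycle a b := by
  have h (a : Fin 7) : (finRotate 7).SameCycle 0 a := ⟨(a : ℕ), finRotate_pow_zero a⟩
  exact (h a).symm.trans (h b)

/-- The cyclic ordering `0, h 0 + 1, …, h 5 + 1`. -/
def ofPerm (h : Perm (Fin 6)) : CyclicOrdering 7 :=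
  ⟨fixZero h * finRotate 7 * (fixZero h)⁻¹, fun a b => by
    rw [Perm.sameCycle_conj]
    exact sameCycle_finRotate _ _⟩

/-- Two conjugators of the rotation with the same result differ by an element of its centralizer.
Such an element is determined by its value at `0`, because the powers of the rotation reach every
point from `0`; here it fixes `0`, so it is trivial. -/
theorem ofPerm_injective : Function.Injective ofPerm := fun g h hgh => by
  have hgh : fixZero g * finRotate 7 * (fixZero g)⁻¹ = fixZero h * finRotate 7 * (fixZero h)⁻¹ :=
    congrArg Subtype.val hgh
  refine fixZero_injective ?_
  have hcomm : Commute ((fixZero h)⁻¹ * fixZero g) (finRotate 7) := by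
    change _ = _
    calc (fixZero h)⁻¹ * fixZero g * finRotate 7
        = (fixZero h)⁻¹ * (fixZero g * finRotate 7 * (fixZero g)⁻¹) * fixZero g := by group
      _ = finRotate 7 * ((fixZero h)⁻¹ * fixZero g) := by rw [hgh]; group
  have hone : (fixZero h)⁻¹ * fixZero g = 1 := by
    ext k : 1
    have h0 : ((fixZero h)⁻¹ * fixZero g) 0 = 0 := by
      rw [Perm.mul_apply, fixZero_zero, Perm.inv_eq_iff_eq, fixZero_zero]
    calc ((fixZero h)⁻¹ * fixZero g) k
        = ((fixZero h)⁻¹ * fixZero g * finRotate 7 ^ (k : ℕ)) 0 := by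
          rw [Perm.mul_apply _ (finRotate 7 ^ (k : ℕ)), finRotate_pow_zero]
      _ = k := by rw [(hcomm.pow_right k).eq, Perm.mul_apply, h0, finRotate_pow_zero]
  exact (inv_mul_eq_one.1 hone).symm

theorem ofPerm_surjective : Function.Surjective ofPerm := fun ρ => by
  have hfix (a : Fin 7) : ρ.1 a ≠ a := fun h => by
    obtain ⟨b, hb⟩ := exists_ne a
    exact hb ((ρ.2 a b).eq_of_left h).symm
  have hc : ρ.1.IsCycle := ⟨0, hfix 0, fun b _ => ρ.2 0 b⟩
  obtain ⟨g, hg⟩ := isConj_iff.1 <| (isCycle_finRotate (n := 5)).isConj hc <| by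
    rw [support_finRotate]
    congr 1
    ext a
    simp [hfix a]
  -- A power of the rotation multiplied on the right of `g` leaves the conjugate unchanged; this
  -- power moves `0` to position `0`.
  have h0 : (g * finRotate 7 ^ ((g⁻¹ 0 : Fin 7) : ℕ)) 0 = 0 := by
    rw [Perm.mul_apply, finRotate_pow_zero]; simp
  obtain ⟨h, hh⟩ := exists_fixZero h0
  refine ⟨h, Subtype.ext ?_⟩
  change fixZero h * finRotate 7 * (fixZero h)⁻¹ = ρ.1
  rw [hh, ← hg]
  group

/-- The cyclic orderings of seven elements, parametrized by the arrangements of the elements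
after `0`. -/
noncomputable def permEquiv : Perm (Fin 6) ≃ CyclicOrdering 7 :=
  Equiv.ofBijective ofPerm ⟨ofPerm_injective, ofPerm_surjective⟩

theorem reverse_ofPerm (h : Perm (Fin 6)) : (ofPerm h).reverse = ofPerm (h * Fin.revPerm) := by
  have hrev : (finRotate 7)⁻¹ = fixZero Fin.revPerm * finRotate 7 * (fixZero Fin.revPerm)⁻¹ := by
    decide
  refine Subtype.ext ?_
  change (fixZero h * finRotate 7 * (fixZero h)⁻¹)⁻¹ = fixZero (h * Fin.revPerm) * finRotate 7 *
    (fixZero (h * Fin.revPerm))⁻¹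
  calc _ = fixZero h * (finRotate 7)⁻¹ * (fixZero h)⁻¹ := by group
    _ = _ := by rw [hrev, fixZero_mul]; group

/-- The rearrangement that interchanges the elements in the positions `i` and `i + 1`, followed by
the rotation that brings `0` back to position `0`. -/
def interchangePerm : Fin 7 → Perm (Fin 6) :=
  ![finRotate 6, swap 0 1, swap 1 2, swap 2 3, swap 3 4, swap 4 5, (finRotate 6)⁻¹]

/-- The case of the standard ordering, to which the general case reduces by renaming. The positions
`0` and `6` are special: there `0` itself moves, and renormalizing it to position `0` rotates the
six other elements. -/
theorem swap_conj_finRotate (i : Fin 7) :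
    swap i (finRotate 7 i) * finRotate 7 * (swap i (finRotate 7 i))⁻¹ =
      fixZero (interchangePerm i) * finRotate 7 * (fixZero (interchangePerm i))⁻¹ := by
  revert i
  decide

theorem IsInterchange.exists_ofPerm {h : Perm (Fin 6)} {ρ : CyclicOrdering 7}
    (hρ : IsInterchange (ofPerm h) ρ) : ∃ i, ρ = ofPerm (h * interchangePerm i) := by
  obtain ⟨a, ha⟩ := hρ
  refine ⟨(fixZero h)⁻¹ a, Subtype.ext ?_⟩
  set i := (fixZero h)⁻¹ a with hi
  have hai : a = fixZero h i := by simp [hi]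
  have hb : (ofPerm h).1 a = fixZero h (finRotate 7 i) := by
    change (fixZero h * finRotate 7 * (fixZero h)⁻¹) a = _
    rw [Perm.mul_apply, Perm.mul_apply, ← hi]
  have hs : swap a ((ofPerm h).1 a) = fixZero h * swap i (finRotate 7 i) * (fixZero h)⁻¹ := by
    rw [hb, hai]
    exact swap_apply_apply _ _ _
  rw [ha, hs]
  change fixZero h * swap i (finRotate 7 i) * (fixZero h)⁻¹ *
    (fixZero h * finRotate 7 * (fixZero h)⁻¹) *
    (fixZero h * swap i (finRotate 7 i) * (fixZero h)⁻¹)⁻¹ =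
    fixZero (h * interchangePerm i) * finRotate 7 * (fixZero (h * interchangePerm i))⁻¹
  calc _ = fixZero h * (swap i (finRotate 7 i) * finRotate 7 * (swap i (finRotate 7 i))⁻¹) *
        (fixZero h)⁻¹ := by group
    _ = _ := by rw [swap_conj_finRotate, fixZero_mul]; group

/-- A function on arrangements that grows by at most one with each interchange bounds the
interchange distance from below. -/
theorem le_interchangeDist_ofPerm {d : Perm (Fin 6) → ℕ} (hone : d 1 = 0)
    (hstep : ∀ h i, d (h * interchangePerm i) ≤ d h + 1) (g h : Perm (Fin 6)) :
    d (g⁻¹ * h) ≤ (ofPerm g).interchangeDist (ofPerm h) := by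
  -- Nonemptiness matters, since `sInf ∅ = 0` in `ℕ`; with it, a path of minimal length exists and
  -- `d` can be followed along it.
  have hne : {k | ReachableIn k (ofPerm g) (ofPerm h)}.Nonempty := exists_reachableIn _ _
  obtain ⟨p, h0, hk, hp⟩ := Nat.sInf_mem hne
  have key : ∀ j ≤ (ofPerm g).interchangeDist (ofPerm h), ∃ f, p j = ofPerm f ∧ d (g⁻¹ * f) ≤ j := by
    intro j
    induction j with
    | zero => exact fun _ => ⟨g, h0, by simp [hone]⟩
    | succ j ih =>
      intro hj
      obtain ⟨f, hf, hd⟩ := ih (by omega)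
      have hint := hp j hj
      rw [hf] at hint
      obtain ⟨i, hi⟩ := hint.exists_ofPerm
      refine ⟨f * interchangePerm i, hi, ?_⟩
      rw [← mul_assoc]
      exact (hstep _ i).trans (by omega)
  obtain ⟨f, hf, hd⟩ := key _ le_rfl
  obtain rfl : h = f := ofPerm_injective (hk.symm.trans hf)
  exact hd

end CyclicOrdering

/-! ### Quadratic forms on the simplex -/

/-- A correlation bound `∑ g, w g * w (h * g) ≤ N * e h + T` yields a lower bound on the simplex for
the quadratic form with the matrix `e (g⁻¹ * h)`. -/
theorem sq_sum_div_card_le_of_correlation_le {G : Type*} [Group G] [Fintype G] {w e : G → ℝ}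
    {N T : ℝ} (hw : ∀ h, ∑ g, w g * w (h * g) ≤ N * e h + T) {x : G → ℝ} (hx : ∀ g, 0 ≤ x g)
    (hsum : ∑ g, x g = 1) :
    (∑ g, w g) ^ 2 / Fintype.card G ≤ N * (∑ g, ∑ h, x g * x h * e (g⁻¹ * h)) + T := by
  -- The Gram structure: after the substitution `k ↦ h * k` the coefficient of `x g * x h` is the
  -- correlation at `g⁻¹ * h`.
  have hsq : ∑ k, (∑ h, x h * w (h⁻¹ * k)) ^ 2 = ∑ g, ∑ h, x g * x h *
      ∑ k, w k * w (g⁻¹ * h * k) := by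
    simp_rw [sq, Finset.sum_mul_sum]
    rw [Finset.sum_comm]
    refine Finset.sum_congr rfl fun g _ => ?_
    rw [Finset.sum_comm]
    refine Finset.sum_congr rfl fun h _ => ?_
    rw [Finset.mul_sum, ← Equiv.sum_comp (Equiv.mulLeft h)]
    refine Finset.sum_congr rfl fun k _ => ?_
    simp only [Equiv.coe_mulLeft, inv_mul_cancel_left, mul_assoc]
    ring
  have hmean : ∑ k, ∑ h, x h * w (h⁻¹ * k) = ∑ g, w g := by
    rw [Finset.sum_comm]
    have (h : G) : ∑ k, x h * w (h⁻¹ * k) = x h * ∑ g, w g := by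
      rw [Finset.mul_sum, ← Equiv.sum_comp (Equiv.mulLeft h)]
      simp
    simp_rw [this]
    rw [← Finset.sum_mul, hsum, one_mul]
  have hcs : (∑ g, w g) ^ 2 ≤ Fintype.card G * ∑ k, (∑ h, x h * w (h⁻¹ * k)) ^ 2 := by
    rw [← hmean]
    exact sq_sum_le_card_mul_sum_sq
  have hcard : (0 : ℝ) < Fintype.card G := by exact_mod_cast Fintype.card_pos
  rw [div_le_iff₀' hcard]
  refine hcs.trans (mul_le_mul_of_nonneg_left ?_ hcard.le)
  rw [hsq]
  calc _ ≤ ∑ g, ∑ h, x g * x h * (N * e (g⁻¹ * h) + T) :=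
        Finset.sum_le_sum fun g _ => Finset.sum_le_sum fun h _ =>
          mul_le_mul_of_nonneg_left (hw _) (mul_nonneg (hx g) (hx h))
    _ = N * (∑ g, ∑ h, x g * x h * e (g⁻¹ * h)) + T * ((∑ g, x g) * ∑ h, x h) := by
        simp_rw [Finset.sum_mul_sum, Finset.mul_sum, ← Finset.sum_add_distrib]
        refine Finset.sum_congr rfl fun g _ => Finset.sum_congr rfl fun h _ => ?_
        ring
    _ = _ := by rw [hsum]; ring

/-- A quadratic form attains its minimum on the standard simplex. -/
theorem exists_isLeast_dotProduct_mulVec {ι : Type*} [Fintype ι] [Nonempty ι] (A : Matrix ι ι ℝ) :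
    ∃ p : ℝ, IsLeast {v : ℝ | ∃ x : ι → ℝ,
      (∀ i, 0 ≤ x i) ∧ ∑ i, x i = 1 ∧ v = x ⬝ᵥ (A *ᵥ x)} p := by
  classical
  have hcont : Continuous fun x : ι → ℝ => x ⬝ᵥ (A *ᵥ x) :=
    continuous_id.dotProduct (continuous_const.matrix_mulVec continuous_id)
  obtain ⟨x, hx, hmin⟩ := (isCompact_stdSimplex ℝ ι).exists_isMinOn
    ⟨_, single_mem_stdSimplex ℝ (Classical.arbitrary ι)⟩ hcont.continuousOn
  refine ⟨_, ⟨x, hx.1, hx.2, rfl⟩, ?_⟩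
  rintro _ ⟨y, hy0, hy1, rfl⟩
  exact hmin ⟨hy0, hy1⟩

/-! ### Decision trees, the certificate and its verification -/

/-- Decision trees for functions on the permutations of `Fin 6`: the children of a node are indexed
by the next value of the permutation, and five values determine it. -/
inductive PermTree where
  | n : PermTree
  | l (a : ℕ) : PermTree
  | b (x0 x1 x2 x3 x4 x5 : PermTree) : PermTree

namespace PermTree

set_option maxRecDepth 10000 in
/-- The weights of the certificate. -/
def weight : PermTree :=
  b (b n (b n n (b n n n (b n n n n (l 68937) (l 52885)) (b n n n (l 52885) n (l 44929)) (b n n n (l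
  44929) (l 38358) n)) (b n n (b n n n n (l 52885) (l 46248)) n (b n n (l 44929) n n (l 41468)) (b n
  n (l 37806) n (l 34444) n)) (b n n (b n n n (l 44929) n (l 37806)) (b n n (l 38358) n n (l 34444))
  n (b n n (l 35246) (l 26443) n n)) (b n n (b n n n (l 41468) (l 34444) n) (b n n (l 34444) n (l
  23755) n) (b n n (l 26443) (l 20750) n n) n)) (b n (b n n n (b n n n n (l 52885) (l 49261)) (b n n
  n (l 46248) n (l 40303)) (b n n n (l 40303) (l 34024) n)) n (b n (b n n n n (l 44929) (l 40303)) n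
  n (b n (l 41468) n n n (l 44929)) (b n (l 38887) n n (l 40303) n)) (b n (b n n n (l 37806) n (l
  35842)) n (b n (l 34444) n n n (l 37586)) n (b n (l 31120) n (l 30547) n n)) (b n (b n n n (l
  38887) (l 31411) n) n (b n (l 33302) n n (l 34749) n) (b n (l 27265) n (l 25130) n n) n)) (b n (b
  n n (b n n n n (l 44929) (l 40303)) n (b n n (l 37806) n n (l 38887)) (b n n (l 35842) n (l 31411)
  n)) (b n (b n n n n (l 38358) (l 34024)) n n (b n (l 34444) n n n (l 40303)) (b n (l 31411) n n (l
  34970) n)) n (b n (b n n (l 35246) n n (l 31120)) (b n (l 26443) n n n (l 30547)) n n (b n (l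
  35246) (l 26443) n n n)) (b n (b n n (l 31120) n (l 31140) n) (b n (l 27265) n n (l 26489) n) n (b
  n (l 27269) (l 22241) n n n) n)) (b n (b n n (b n n n (l 41468) n (l 38887)) (b n n (l 34444) n n
  (l 33302)) n (b n n (l 31120) (l 27265) n n)) (b n (b n n n (l 34444) n (l 31411)) n (b n (l
  23755) n n n (l 34749)) n (b n (l 31140) n (l 26489) n n)) (b n (b n n (l 26443) n n (l 27265)) (b
  n (l 20750) n n n (l 25130)) n n (b n (l 27269) (l 22241) n n n)) n (b n (b n n (l 35246) (l
  27269) n n) (b n (l 27269) n (l 21504) n n) (b n (l 21504) (l 13464) n n n) n n)) (b n (b n n (b n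
  n n (l 44929) (l 40303) n) (b n n (l 37586) n (l 34749) n) (b n n (l 30547) (l 25130) n n) n) (b n
  (b n n n (l 40303) (l 34970) n) n (b n (l 34749) n n (l 23755) n) (b n (l 26489) n (l 20098) n n)
  n) (b n (b n n (l 30547) n (l 26489) n) (b n (l 25130) n n (l 20098) n) n (b n (l 21504) (l 14877)
  n n n) n) (b n (b n n (l 26443) (l 22241) n n) (b n (l 22241) n (l 14877) n n) (b n (l 13464) (l
  7447) n n n) n n) n)) (b (b n n (b n n n (b n n n n (l 52885) (l 49261)) (b n n n (l 49261) n (l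
  37586)) (b n n n (l 37586) (l 28589) n)) (b n n (b n n n n (l 46248) (l 39320)) n (b n n (l 40303)
  n n (l 34444)) (b n n (l 33563) n (l 27377) n)) (b n n (b n n n (l 40303) n (l 33563)) (b n n (l
  34024) n n (l 25348)) n (b n n (l 27269) (l 22241) n n)) (b n n (b n n n (l 34444) (l 27377) n) (b
  n n (l 25348) n (l 20098) n) (b n n (l 22241) (l 12355) n n) n)) n (b (b n n n (b n n n n (l
  44929) (l 37586)) (b n n n (l 40303) n (l 34749)) (b n n n (l 30547) (l 25130) n)) n n (b (b n n n
  n (l 41468) (l 34444)) n n n (b (l 44929) n n n n (l 52885)) (b (l 37806) n n n (l 46248) n)) (b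
  (b n n n (l 38887) n (l 33302)) n n (b (l 40303) n n n n (l 49261)) n (b (l 38887) n n (l 40303) n
  n)) (b (b n n n (l 31120) (l 27265) n) n n (b (l 35842) n n n (l 40303) n) (b (l 31411) n n (l
  34024) n n) n)) (b (b n n (b n n n n (l 37806) (l 33563)) n (b n n (l 35842) n n (l 33302)) (b n n
  (l 28728) n (l 27035) n)) n (b (b n n n n (l 34444) (l 25348)) n n n (b (l 37586) n n n n (l
  49261)) (b (l 33563) n n n (l 39320) n)) n (b (b n n (l 31120) n n (l 35842)) n (b (l 30547) n n n
  n (l 37586)) n n (b (l 37806) n (l 34444) n n n)) (b (b n n (l 33162) n (l 28728) n) n (b (l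
  28728) n n n (l 33563) n) n (b (l 33563) n (l 25348) n n n) n)) (b (b n n (b n n n (l 38887) n (l
  38552)) (b n n (l 31411) n n (l 33859)) n (b n n (l 31140) (l 26528) n n)) n (b (b n n n (l 33302)
  n (l 33859)) n n (b (l 34749) n n n n (l 37586)) n (b (l 38552) n n (l 33563) n n)) (b (b n n (l
  27265) n n (l 26516)) n (b (l 25130) n n n n (l 28589)) n n (b (l 33563) n (l 27377) n n n)) n (b
  (b n n (l 31120) (l 27265) n n) n (b (l 31140) n n (l 27269) n n) (b (l 26489) n (l 22241) n n n)
  n n)) (b (b n n (b n n n (l 37806) (l 33563) n) (b n n (l 33563) n (l 26489) n) (b n n (l 26489)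
  (l 20251) n n) n) n (b (b n n n (l 35842) (l 26516) n) n n (b (l 33302) n n n (l 34444) n) (b (l
  33859) n n (l 25348) n n) n) (b (b n n (l 28728) n (l 25754) n) n (b (l 27035) n n n (l 27377) n)
  n (b (l 26489) n (l 20098) n n n) n) (b (b n n (l 27265) (l 20348) n n) n (b (l 26528) n n (l
  22241) n n) (b (l 20251) n (l 12355) n n n) n n) n)) (b (b n (b n n n (b n n n n (l 44929) (l
  37586)) (b n n n (l 40303) n (l 30547)) (b n n n (l 34749) (l 25130) n)) n (b n (b n n n n (l
  37806) (l 33563)) n n (b n (l 38887) n n n (l 37806)) (b n (l 38552) n n (l 33563) n)) (b n (b n n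
  n (l 35842) n (l 28728)) n (b n (l 31411) n n n (l 33563)) n (b n (l 31140) n (l 26489) n n)) (b n
  (b n n n (l 33302) (l 27035) n) n (b n (l 33859) n n (l 26489) n) (b n (l 26528) n (l 20251) n n)
  n)) (b (b n n n (b n n n n (l 38358) (l 28589)) (b n n n (l 34024) n (l 25130)) (b n n n (l 25130)
  (l 21219) n)) n n (b (b n n n n (l 34444) (l 27377)) n n n (b (l 40303) n n n n (l 46248)) (b (l
  33563) n n n (l 39320) n)) (b (b n n n (l 31411) n (l 27035)) n n (b (l 34970) n n n n (l 39320))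
  n (b (l 31411) n n (l 34970) n n)) (b (b n n n (l 27265) (l 20348) n) n n (b (l 26516) n n n (l
  34970) n) (b (l 25360) n n (l 28888) n n) n)) n (b (b n (b n n n n (l 35246) (l 27269)) n n (b n
  (l 31120) n n n (l 38887)) (b n (l 31140) n n (l 31411) n)) (b (b n n n n (l 26443) (l 22241)) n n
  n (b (l 30547) n n n n (l 40303)) (b (l 26489) n n n (l 34970) n)) n n (b (b n (l 35246) n n n (l
  37806)) (b (l 26443) n n n n (l 34444)) n n n (b (l 44929) (l 38358) n n n n)) (b (b n (l 31120) n
  n (l 35842) n) (b (l 27265) n n n (l 31411) n) n n (b (l 40303) (l 34024) n n n n) n)) (b (b n (b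
  n n n (l 31120) n (l 31140)) n (b n (l 31140) n n n (l 38552)) n (b n (l 38552) n (l 33859) n n))
  (b (b n n n (l 27265) n (l 26528)) n n (b (l 26489) n n n n (l 33563)) n (b (l 33859) n n (l
  26516) n n)) n (b (b n (l 27269) n n n (l 33563)) (b (l 22241) n n n n (l 27377)) n n n (b (l
  37586) (l 28589) n n n n)) n (b (b n (l 38887) n (l 33302) n n) (b (l 31411) n n (l 27265) n n) n
  (b (l 34749) (l 25130) n n n n) n n)) (b (b n (b n n n (l 38887) (l 31411) n) n (b n (l 38552) n n
  (l 31140) n) (b n (l 33859) n (l 26528) n n) n) (b (b n n n (l 31411) (l 25360) n) n n (b (l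
  33859) n n n (l 31411) n) (b (l 33699) n n (l 25360) n n) n) n (b (b n (l 31140) n n (l 28728) n)
  (b (l 26528) n n n (l 27035) n) n n (b (l 30547) (l 25130) n n n n) n) (b (b n (l 31411) n (l
  27035) n n) (b (l 25360) n n (l 20348) n n) n (b (l 25130) (l 21219) n n n n) n n) n)) (b (b n (b
  n n (b n n n n (l 41468) (l 34444)) n (b n n (l 38887) n n (l 31120)) (b n n (l 33302) n (l 27265)
  n)) (b n (b n n n n (l 34444) (l 25348)) n n (b n (l 33302) n n n (l 35842)) (b n (l 33859) n n (l
  26516) n)) n (b n (b n n (l 31120) n n (l 33162)) (b n (l 27265) n n n (l 28728)) n n (b n (l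
  31120) (l 27265) n n n)) (b n (b n n (l 35842) n (l 28728) n) (b n (l 26516) n n (l 25754) n) n (b
  n (l 27265) (l 20348) n n n) n)) (b (b n n (b n n n n (l 34444) (l 27377)) n (b n n (l 31411) n n
  (l 27265)) (b n n (l 27035) n (l 20348) n)) n (b (b n n n n (l 23755) (l 20098)) n n n (b (l
  34749) n n n n (l 40303)) (b (l 26489) n n n (l 34970) n)) n (b (b n n (l 31140) n n (l 28728)) n
  (b (l 26489) n n n n (l 33563)) n n (b (l 35842) n (l 31411) n n n)) (b (b n n (l 28728) n (l
  25754) n) n (b (l 25754) n n n (l 26516) n) n (b (l 26516) n (l 25360) n n n) n)) (b (b n (b n n n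
  n (l 26443) (l 22241)) n n (b n (l 27265) n n n (l 31411)) (b n (l 26528) n n (l 25360) n)) (b (b
  n n n n (l 20750) (l 12355)) n n n (b (l 25130) n n n n (l 34024)) (b (l 20251) n n n (l 28888)
  n)) n n (b (b n (l 27269) n n n (l 33563)) (b (l 22241) n n n n (l 25348)) n n n (b (l 40303) (l
  34024) n n n n)) (b (b n (l 27265) n n (l 26516) n) (b (l 20348) n n n (l 25360) n) n n (b (l
  34970) (l 28888) n n n n) n)) n (b (b n (b n n (l 35246) n n (l 31120)) (b n (l 27269) n n n (l
  31140)) n n (b n (l 38887) (l 31411) n n n)) (b (b n n (l 27269) n n (l 27265)) n (b (l 21504) n n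
  n n (l 27269)) n n (b (l 33302) n (l 27265) n n n)) (b (b n (l 21504) n n n (l 26489)) (b (l
  13464) n n n n (l 22241)) n n n (b (l 34749) (l 25130) n n n n)) n n (b (b n (l 41468) (l 34444) n
  n n) (b (l 34444) n (l 26443) n n n) (b (l 23755) (l 20750) n n n n) n n n)) (b (b n (b n n (l
  37806) n (l 35842) n) (b n (l 33563) n n (l 28728) n) n (b n (l 33302) (l 27035) n n n) n) (b (b n
  n (l 33563) n (l 26516) n) n (b (l 26489) n n n (l 27265) n) n (b (l 33859) n (l 26528) n n n) n)
  (b (b n (l 26489) n n (l 25754) n) (b (l 20251) n n n (l 20348) n) n n (b (l 26489) (l 20251) n n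
  n n) n) n (b (b n (l 34444) (l 27377) n n n) (b (l 25348) n (l 22241) n n n) (b (l 20098) (l
  12355) n n n n) n n n) n)) (b (b n (b n n (b n n n (l 44929) n (l 37806)) (b n n (l 40303) n n (l
  35842)) n (b n n (l 38887) (l 31411) n n)) (b n (b n n n (l 37586) n (l 33563)) n (b n (l 34749) n
  n n (l 33302)) n (b n (l 38552) n (l 33859) n n)) (b n (b n n (l 30547) n n (l 28728)) (b n (l
  25130) n n n (l 27035)) n n (b n (l 31140) (l 26528) n n n)) n (b n (b n n (l 37806) (l 33563) n
  n) (b n (l 33563) n (l 26489) n n) (b n (l 26489) (l 20251) n n n) n n)) (b (b n n (b n n n (l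
  40303) n (l 33563)) (b n n (l 34970) n n (l 26516)) n (b n n (l 31411) (l 25360) n n)) n (b (b n n
  n (l 34749) n (l 26489)) n n (b (l 23755) n n n n (l 34444)) n (b (l 31140) n n (l 31411) n n)) (b
  (b n n (l 26489) n n (l 25754)) n (b (l 20098) n n n n (l 27377)) n n (b (l 28728) n (l 27035) n n
  n)) n (b (b n n (l 35842) (l 26516) n n) n (b (l 28728) n n (l 27265) n n) (b (l 25754) n (l
  20348) n n n) n n)) (b (b n (b n n n (l 30547) n (l 26489)) n (b n (l 26489) n n n (l 33859)) n (b
  n (l 33859) n (l 33699) n n)) (b (b n n n (l 25130) n (l 20251)) n n (b (l 20098) n n n n (l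
  25348)) n (b (l 26528) n n (l 25360) n n)) n (b (b n (l 21504) n n n (l 26489)) (b (l 14877) n n n
  n (l 20098)) n n n (b (l 30547) (l 25130) n n n n)) n (b (b n (l 33302) n (l 33859) n n) (b (l
  27035) n n (l 26528) n n) n (b (l 26489) (l 20251) n n n n) n n)) (b (b n (b n n (l 26443) n n (l
  27265)) (b n (l 22241) n n n (l 26528)) n n (b n (l 31411) (l 25360) n n n)) (b (b n n (l 22241) n
  n (l 20348)) n (b (l 14877) n n n n (l 22241)) n n (b (l 27035) n (l 20348) n n n)) (b (b n (l
  13464) n n n (l 20251)) (b (l 7447) n n n n (l 12355)) n n n (b (l 25130) (l 21219) n n n n)) n n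
  (b (b n (l 34444) (l 25348) n n n) (b (l 27377) n (l 22241) n n n) (b (l 20098) (l 12355) n n n n)
  n n n)) n (b (b n (b n n (l 44929) (l 40303) n n) (b n (l 37586) n (l 30547) n n) (b n (l 34749)
  (l 25130) n n n) n n) (b (b n n (l 40303) (l 34970) n n) n (b (l 30547) n n (l 26443) n n) (b (l
  26489) n (l 22241) n n n) n n) (b (b n (l 34749) n (l 26489) n n) (b (l 25130) n n (l 22241) n n)
  n (b (l 21504) (l 13464) n n n n) n n) (b (b n (l 23755) (l 20098) n n n) (b (l 20098) n (l 14877)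
  n n n) (b (l 14877) (l 7447) n n n n) n n n) n n)) (b (b n (b n n (b n n n (l 52885) (l 46248) n)
  (b n n (l 49261) n (l 40303) n) (b n n (l 40303) (l 34024) n n) n) (b n (b n n n (l 49261) (l
  39320) n) n (b n (l 37586) n n (l 34444) n) (b n (l 33563) n (l 25348) n n) n) (b n (b n n (l
  37586) n (l 33563) n) (b n (l 28589) n n (l 27377) n) n (b n (l 27269) (l 22241) n n n) n) (b n (b
  n n (l 34444) (l 25348) n n) (b n (l 27377) n (l 20098) n n) (b n (l 22241) (l 12355) n n n) n n)
  n) (b (b n n (b n n n (l 46248) (l 39320) n) (b n n (l 39320) n (l 34970) n) (b n n (l 34970) (l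
  28888) n n) n) n (b (b n n n (l 40303) (l 34970) n) n n (b (l 34444) n n n (l 38358) n) (b (l
  31411) n n (l 34024) n n) n) (b (b n n (l 33563) n (l 26516) n) n (b (l 27377) n n n (l 28589) n)
  n (b (l 27265) n (l 25130) n n n) n) (b (b n n (l 31411) (l 25360) n n) n (b (l 27035) n n (l
  25130) n n) (b (l 20348) n (l 21219) n n n) n n) n) (b (b n (b n n n (l 40303) (l 34970) n) n (b n
  (l 33563) n n (l 31411) n) (b n (l 26516) n (l 25360) n n) n) (b (b n n n (l 34024) (l 28888) n) n
  n (b (l 25348) n n n (l 34024) n) (b (l 25360) n n (l 28888) n n) n) n (b (b n (l 27269) n n (l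
  27265) n) (b (l 22241) n n n (l 25130) n) n n (b (l 26443) (l 20750) n n n n) n) (b (b n (l 27265)
  n (l 26528) n n) (b (l 20348) n n (l 20251) n n) n (b (l 22241) (l 12355) n n n n) n n) n) (b (b n
  (b n n (l 34444) n (l 31411) n) (b n (l 27377) n n (l 27035) n) n (b n (l 27265) (l 20348) n n n)
  n) (b (b n n (l 25348) n (l 25360) n) n (b (l 20098) n n n (l 25130) n) n (b (l 26528) n (l 20251)
  n n n) n) (b (b n (l 22241) n n (l 20348) n) (b (l 12355) n n n (l 21219) n) n n (b (l 22241) (l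
  12355) n n n n) n) n (b (b n (l 26443) (l 22241) n n n) (b (l 22241) n (l 13464) n n n) (b (l
  14877) (l 7447) n n n n) n n n) n) (b (b n (b n n (l 38358) (l 34024) n n) (b n (l 28589) n (l
  25130) n n) (b n (l 25130) (l 21219) n n n) n n) (b (b n n (l 34024) (l 28888) n n) n (b (l 25130)
  n n (l 20750) n n) (b (l 20251) n (l 12355) n n n) n n) (b (b n (l 25130) n (l 20251) n n) (b (l
  21219) n n (l 12355) n n) n (b (l 13464) (l 7447) n n n n) n n) (b (b n (l 20750) (l 12355) n n n)
  (b (l 12355) n (l 7447) n n n) (b (l 7447) (l 6693) n n n n) n n n) n n) n)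

set_option maxRecDepth 10000 in
/-- The interchange distances from the standard cyclic ordering. -/
def dist : PermTree :=
  b (b n (b n n (b n n n (b n n n n (l 0) (l 1)) (b n n n (l 1) n (l 2)) (b n n n (l 2) (l 3) n)) (b
  n n (b n n n n (l 1) (l 2)) n (b n n (l 2) n n (l 3)) (b n n (l 3) n (l 4) n)) (b n n (b n n n (l
  2) n (l 3)) (b n n (l 3) n n (l 4)) n (b n n (l 4) (l 5) n n)) (b n n (b n n n (l 3) (l 4) n) (b n
  n (l 4) n (l 5) n) (b n n (l 5) (l 6) n n) n)) (b n (b n n n (b n n n n (l 1) (l 2)) (b n n n (l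
  2) n (l 3)) (b n n n (l 3) (l 4) n)) n (b n (b n n n n (l 2) (l 3)) n n (b n (l 3) n n n (l 2)) (b
  n (l 4) n n (l 3) n)) (b n (b n n n (l 3) n (l 4)) n (b n (l 4) n n n (l 3)) n (b n (l 5) n (l 4)
  n n)) (b n (b n n n (l 4) (l 5) n) n (b n (l 5) n n (l 4) n) (b n (l 6) n (l 5) n n) n)) (b n (b n
  n (b n n n n (l 2) (l 3)) n (b n n (l 3) n n (l 4)) (b n n (l 4) n (l 5) n)) (b n (b n n n n (l 3)
  (l 4)) n n (b n (l 4) n n n (l 3)) (b n (l 5) n n (l 4) n)) n (b n (b n n (l 4) n n (l 5)) (b n (l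
  5) n n n (l 4)) n n (b n (l 4) (l 5) n n n)) (b n (b n n (l 5) n (l 6) n) (b n (l 6) n n (l 5) n)
  n (b n (l 5) (l 6) n n n) n)) (b n (b n n (b n n n (l 3) n (l 4)) (b n n (l 4) n n (l 5)) n (b n n
  (l 5) (l 6) n n)) (b n (b n n n (l 4) n (l 5)) n (b n (l 5) n n n (l 4)) n (b n (l 6) n (l 5) n
  n)) (b n (b n n (l 5) n n (l 6)) (b n (l 6) n n n (l 5)) n n (b n (l 5) (l 6) n n n)) n (b n (b n
  n (l 4) (l 5) n n) (b n (l 5) n (l 6) n n) (b n (l 6) (l 7) n n n) n n)) (b n (b n n (b n n n (l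
  2) (l 3) n) (b n n (l 3) n (l 4) n) (b n n (l 4) (l 5) n n) n) (b n (b n n n (l 3) (l 4) n) n (b n
  (l 4) n n (l 5) n) (b n (l 5) n (l 6) n n) n) (b n (b n n (l 4) n (l 5) n) (b n (l 5) n n (l 6) n)
  n (b n (l 6) (l 7) n n n) n) (b n (b n n (l 5) (l 6) n n) (b n (l 6) n (l 7) n n) (b n (l 7) (l 8)
  n n n) n n) n)) (b (b n n (b n n n (b n n n n (l 1) (l 2)) (b n n n (l 2) n (l 3)) (b n n n (l 3)
  (l 4) n)) (b n n (b n n n n (l 2) (l 3)) n (b n n (l 3) n n (l 4)) (b n n (l 4) n (l 5) n)) (b n n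
  (b n n n (l 3) n (l 4)) (b n n (l 4) n n (l 5)) n (b n n (l 5) (l 6) n n)) (b n n (b n n n (l 4)
  (l 5) n) (b n n (l 5) n (l 6) n) (b n n (l 6) (l 7) n n) n)) n (b (b n n n (b n n n n (l 2) (l 3))
  (b n n n (l 3) n (l 4)) (b n n n (l 4) (l 5) n)) n n (b (b n n n n (l 3) (l 4)) n n n (b (l 2) n n
  n n (l 1)) (b (l 3) n n n (l 2) n)) (b (b n n n (l 4) n (l 5)) n n (b (l 3) n n n n (l 2)) n (b (l
  4) n n (l 3) n n)) (b (b n n n (l 5) (l 6) n) n n (b (l 4) n n n (l 3) n) (b (l 5) n n (l 4) n n)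
  n)) (b (b n n (b n n n n (l 3) (l 4)) n (b n n (l 4) n n (l 5)) (b n n (l 5) n (l 6) n)) n (b (b n
  n n n (l 4) (l 5)) n n n (b (l 3) n n n n (l 2)) (b (l 4) n n n (l 3) n)) n (b (b n n (l 5) n n (l
  4)) n (b (l 4) n n n n (l 3)) n n (b (l 3) n (l 4) n n n)) (b (b n n (l 6) n (l 5) n) n (b (l 5) n
  n n (l 4) n) n (b (l 4) n (l 5) n n n) n)) (b (b n n (b n n n (l 4) n (l 5)) (b n n (l 5) n n (l
  6)) n (b n n (l 6) (l 7) n n)) n (b (b n n n (l 5) n (l 6)) n n (b (l 4) n n n n (l 3)) n (b (l 5)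
  n n (l 4) n n)) (b (b n n (l 6) n n (l 5)) n (b (l 5) n n n n (l 4)) n n (b (l 4) n (l 5) n n n))
  n (b (b n n (l 5) (l 6) n n) n (b (l 6) n n (l 5) n n) (b (l 5) n (l 6) n n n) n n)) (b (b n n (b
  n n n (l 3) (l 4) n) (b n n (l 4) n (l 5) n) (b n n (l 5) (l 6) n n) n) n (b (b n n n (l 4) (l 5)
  n) n n (b (l 5) n n n (l 4) n) (b (l 6) n n (l 5) n n) n) (b (b n n (l 5) n (l 6) n) n (b (l 6) n
  n n (l 5) n) n (b (l 5) n (l 6) n n n) n) (b (b n n (l 6) (l 7) n n) n (b (l 7) n n (l 6) n n) (b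
  (l 6) n (l 7) n n n) n n) n)) (b (b n (b n n n (b n n n n (l 2) (l 3)) (b n n n (l 3) n (l 4)) (b
  n n n (l 4) (l 5) n)) n (b n (b n n n n (l 3) (l 4)) n n (b n (l 4) n n n (l 3)) (b n (l 5) n n (l
  4) n)) (b n (b n n n (l 4) n (l 5)) n (b n (l 5) n n n (l 4)) n (b n (l 6) n (l 5) n n)) (b n (b n
  n n (l 5) (l 6) n) n (b n (l 6) n n (l 5) n) (b n (l 7) n (l 6) n n) n)) (b (b n n n (b n n n n (l
  3) (l 4)) (b n n n (l 4) n (l 5)) (b n n n (l 5) (l 6) n)) n n (b (b n n n n (l 4) (l 5)) n n n (b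
  (l 3) n n n n (l 2)) (b (l 4) n n n (l 3) n)) (b (b n n n (l 5) n (l 6)) n n (b (l 4) n n n n (l
  3)) n (b (l 5) n n (l 4) n n)) (b (b n n n (l 6) (l 7) n) n n (b (l 5) n n n (l 4) n) (b (l 6) n n
  (l 5) n n) n)) n (b (b n (b n n n n (l 4) (l 5)) n n (b n (l 5) n n n (l 4)) (b n (l 6) n n (l 5)
  n)) (b (b n n n n (l 5) (l 6)) n n n (b (l 4) n n n n (l 3)) (b (l 5) n n n (l 4) n)) n n (b (b n
  (l 4) n n n (l 3)) (b (l 5) n n n n (l 4)) n n n (b (l 2) (l 3) n n n n)) (b (b n (l 5) n n (l 4)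
  n) (b (l 6) n n n (l 5) n) n n (b (l 3) (l 4) n n n n) n)) (b (b n (b n n n (l 5) n (l 6)) n (b n
  (l 6) n n n (l 5)) n (b n (l 5) n (l 6) n n)) (b (b n n n (l 6) n (l 7)) n n (b (l 5) n n n n (l
  4)) n (b (l 6) n n (l 5) n n)) n (b (b n (l 5) n n n (l 4)) (b (l 6) n n n n (l 5)) n n n (b (l 3)
  (l 4) n n n n)) n (b (b n (l 4) n (l 5) n n) (b (l 5) n n (l 6) n n) n (b (l 4) (l 5) n n n n) n
  n)) (b (b n (b n n n (l 4) (l 5) n) n (b n (l 5) n n (l 6) n) (b n (l 6) n (l 7) n n) n) (b (b n n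
  n (l 5) (l 6) n) n n (b (l 6) n n n (l 5) n) (b (l 7) n n (l 6) n n) n) n (b (b n (l 6) n n (l 5)
  n) (b (l 7) n n n (l 6) n) n n (b (l 4) (l 5) n n n n) n) (b (b n (l 5) n (l 6) n n) (b (l 6) n n
  (l 7) n n) n (b (l 5) (l 6) n n n n) n n) n)) (b (b n (b n n (b n n n n (l 3) (l 4)) n (b n n (l
  4) n n (l 5)) (b n n (l 5) n (l 6) n)) (b n (b n n n n (l 4) (l 5)) n n (b n (l 5) n n n (l 4)) (b
  n (l 6) n n (l 5) n)) n (b n (b n n (l 5) n n (l 6)) (b n (l 6) n n n (l 5)) n n (b n (l 5) (l 6)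
  n n n)) (b n (b n n (l 4) n (l 5) n) (b n (l 5) n n (l 6) n) n (b n (l 6) (l 7) n n n) n)) (b (b n
  n (b n n n n (l 4) (l 5)) n (b n n (l 5) n n (l 6)) (b n n (l 6) n (l 7) n)) n (b (b n n n n (l 5)
  (l 6)) n n n (b (l 4) n n n n (l 3)) (b (l 5) n n n (l 4) n)) n (b (b n n (l 6) n n (l 5)) n (b (l
  5) n n n n (l 4)) n n (b (l 4) n (l 5) n n n)) (b (b n n (l 5) n (l 6) n) n (b (l 6) n n n (l 5)
  n) n (b (l 5) n (l 6) n n n) n)) (b (b n (b n n n n (l 5) (l 6)) n n (b n (l 6) n n n (l 5)) (b n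
  (l 7) n n (l 6) n)) (b (b n n n n (l 6) (l 7)) n n n (b (l 5) n n n n (l 4)) (b (l 6) n n n (l 5)
  n)) n n (b (b n (l 5) n n n (l 4)) (b (l 6) n n n n (l 5)) n n n (b (l 3) (l 4) n n n n)) (b (b n
  (l 6) n n (l 5) n) (b (l 7) n n n (l 6) n) n n (b (l 4) (l 5) n n n n) n)) n (b (b n (b n n (l 4)
  n n (l 5)) (b n (l 5) n n n (l 6)) n n (b n (l 4) (l 5) n n n)) (b (b n n (l 5) n n (l 6)) n (b (l
  6) n n n n (l 5)) n n (b (l 5) n (l 6) n n n)) (b (b n (l 6) n n n (l 5)) (b (l 7) n n n n (l 6))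
  n n n (b (l 4) (l 5) n n n n)) n n (b (b n (l 3) (l 4) n n n) (b (l 4) n (l 5) n n n) (b (l 5) (l
  6) n n n n) n n n)) (b (b n (b n n (l 3) n (l 4) n) (b n (l 4) n n (l 5) n) n (b n (l 5) (l 6) n n
  n) n) (b (b n n (l 4) n (l 5) n) n (b (l 5) n n n (l 6) n) n (b (l 6) n (l 7) n n n) n) (b (b n (l
  5) n n (l 6) n) (b (l 6) n n n (l 7) n) n n (b (l 5) (l 6) n n n n) n) n (b (b n (l 4) (l 5) n n
  n) (b (l 5) n (l 6) n n n) (b (l 6) (l 7) n n n n) n n n) n)) (b (b n (b n n (b n n n (l 2) n (l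
  3)) (b n n (l 3) n n (l 4)) n (b n n (l 4) (l 5) n n)) (b n (b n n n (l 3) n (l 4)) n (b n (l 4) n
  n n (l 5)) n (b n (l 5) n (l 6) n n)) (b n (b n n (l 4) n n (l 5)) (b n (l 5) n n n (l 6)) n n (b
  n (l 6) (l 7) n n n)) n (b n (b n n (l 3) (l 4) n n) (b n (l 4) n (l 5) n n) (b n (l 5) (l 6) n n
  n) n n)) (b (b n n (b n n n (l 3) n (l 4)) (b n n (l 4) n n (l 5)) n (b n n (l 5) (l 6) n n)) n (b
  (b n n n (l 4) n (l 5)) n n (b (l 5) n n n n (l 4)) n (b (l 6) n n (l 5) n n)) (b (b n n (l 5) n n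
  (l 6)) n (b (l 6) n n n n (l 5)) n n (b (l 5) n (l 6) n n n)) n (b (b n n (l 4) (l 5) n n) n (b (l
  5) n n (l 6) n n) (b (l 6) n (l 7) n n n) n n)) (b (b n (b n n n (l 4) n (l 5)) n (b n (l 5) n n n
  (l 6)) n (b n (l 6) n (l 7) n n)) (b (b n n n (l 5) n (l 6)) n n (b (l 6) n n n n (l 5)) n (b (l
  7) n n (l 6) n n)) n (b (b n (l 6) n n n (l 5)) (b (l 7) n n n n (l 6)) n n n (b (l 4) (l 5) n n n
  n)) n (b (b n (l 5) n (l 6) n n) (b (l 6) n n (l 7) n n) n (b (l 5) (l 6) n n n n) n n)) (b (b n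
  (b n n (l 5) n n (l 6)) (b n (l 6) n n n (l 7)) n n (b n (l 5) (l 6) n n n)) (b (b n n (l 6) n n
  (l 7)) n (b (l 7) n n n n (l 6)) n n (b (l 6) n (l 7) n n n)) (b (b n (l 7) n n n (l 6)) (b (l 8)
  n n n n (l 7)) n n n (b (l 5) (l 6) n n n n)) n n (b (b n (l 4) (l 5) n n n) (b (l 5) n (l 6) n n
  n) (b (l 6) (l 7) n n n n) n n n)) n (b (b n (b n n (l 2) (l 3) n n) (b n (l 3) n (l 4) n n) (b n
  (l 4) (l 5) n n n) n n) (b (b n n (l 3) (l 4) n n) n (b (l 4) n n (l 5) n n) (b (l 5) n (l 6) n n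
  n) n n) (b (b n (l 4) n (l 5) n n) (b (l 5) n n (l 6) n n) n (b (l 6) (l 7) n n n n) n n) (b (b n
  (l 5) (l 6) n n n) (b (l 6) n (l 7) n n n) (b (l 7) (l 8) n n n n) n n n) n n)) (b (b n (b n n (b
  n n n (l 1) (l 2) n) (b n n (l 2) n (l 3) n) (b n n (l 3) (l 4) n n) n) (b n (b n n n (l 2) (l 3)
  n) n (b n (l 3) n n (l 4) n) (b n (l 4) n (l 5) n n) n) (b n (b n n (l 3) n (l 4) n) (b n (l 4) n
  n (l 5) n) n (b n (l 5) (l 6) n n n) n) (b n (b n n (l 4) (l 5) n n) (b n (l 5) n (l 6) n n) (b n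
  (l 6) (l 7) n n n) n n) n) (b (b n n (b n n n (l 2) (l 3) n) (b n n (l 3) n (l 4) n) (b n n (l 4)
  (l 5) n n) n) n (b (b n n n (l 3) (l 4) n) n n (b (l 4) n n n (l 3) n) (b (l 5) n n (l 4) n n) n)
  (b (b n n (l 4) n (l 5) n) n (b (l 5) n n n (l 4) n) n (b (l 6) n (l 5) n n n) n) (b (b n n (l 5)
  (l 6) n n) n (b (l 6) n n (l 5) n n) (b (l 7) n (l 6) n n n) n n) n) (b (b n (b n n n (l 3) (l 4)
  n) n (b n (l 4) n n (l 5) n) (b n (l 5) n (l 6) n n) n) (b (b n n n (l 4) (l 5) n) n n (b (l 5) n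
  n n (l 4) n) (b (l 6) n n (l 5) n n) n) n (b (b n (l 5) n n (l 6) n) (b (l 6) n n n (l 5) n) n n
  (b (l 5) (l 6) n n n n) n) (b (b n (l 6) n (l 7) n n) (b (l 7) n n (l 6) n n) n (b (l 6) (l 7) n n
  n n) n n) n) (b (b n (b n n (l 4) n (l 5) n) (b n (l 5) n n (l 6) n) n (b n (l 6) (l 7) n n n) n)
  (b (b n n (l 5) n (l 6) n) n (b (l 6) n n n (l 5) n) n (b (l 7) n (l 6) n n n) n) (b (b n (l 6) n
  n (l 7) n) (b (l 7) n n n (l 6) n) n n (b (l 6) (l 7) n n n n) n) n (b (b n (l 5) (l 6) n n n) (b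
  (l 6) n (l 7) n n n) (b (l 7) (l 8) n n n n) n n n) n) (b (b n (b n n (l 3) (l 4) n n) (b n (l 4)
  n (l 5) n n) (b n (l 5) (l 6) n n n) n n) (b (b n n (l 4) (l 5) n n) n (b (l 5) n n (l 6) n n) (b
  (l 6) n (l 7) n n n) n n) (b (b n (l 5) n (l 6) n n) (b (l 6) n n (l 7) n n) n (b (l 7) (l 8) n n
  n n) n n) (b (b n (l 6) (l 7) n n n) (b (l 7) n (l 8) n n n) (b (l 8) (l 9) n n n n) n n n) n n)
  n)

/-- The number at a leaf. -/
noncomputable def val (x : PermTree) : ℕ :=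
  PermTree.rec 0 (fun a => a) (fun _ _ _ _ _ _ _ _ _ _ _ _ => 0) x

/-- The child of a node selected by `s`. -/
noncomputable def select (s : PermTree → PermTree → PermTree → PermTree → PermTree → PermTree →
    PermTree) (x : PermTree) : PermTree :=
  PermTree.rec n (fun _ => n) (fun x0 x1 x2 x3 x4 x5 _ _ _ _ _ _ => s x0 x1 x2 x3 x4 x5) x

/-- Pass the selector of the `i`-th child to a continuation; this order of evaluation keeps the
selectors in normal form during the traversal of a tree. -/
noncomputable def withChild {α : Type} (i : Fin 6) (k : (PermTree → PermTree) → α) : α :=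
  match i.1 with
  | 0 => k (select fun x _ _ _ _ _ => x)
  | 1 => k (select fun _ x _ _ _ _ => x)
  | 2 => k (select fun _ _ x _ _ _ => x)
  | 3 => k (select fun _ _ _ x _ _ => x)
  | 4 => k (select fun _ _ _ _ x _ => x)
  | _ => k (select fun _ _ _ _ _ x => x)

/-- The `i`-th child. -/
noncomputable def child (i : Fin 6) (x : PermTree) : PermTree :=
  withChild i fun s => s x

theorem withChild_eq {α : Type} (i : Fin 6) (k : (PermTree → PermTree) → α) :
    withChild i k = k (child i) := by
  fin_cases i <;> rfl

/-- The number at the end of a path. -/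
noncomputable def look (x : PermTree) (i j k m p : Fin 6) : ℕ :=
  val (child p (child m (child k (child j (child i x)))))

/-- The value of the function represented by a tree. -/
noncomputable def eval (x : PermTree) (h : Perm (Fin 6)) : ℕ :=
  x.look (h 0) (h 1) (h 2) (h 3) (h 4)

/-- The sum of the products of the numbers at the leaves of `x` and the corresponding leaves of `y`,
where the `i`-th child in `x` corresponds to the child selected by `pᵢ` in `y`. -/
noncomputable def dot (p0 p1 p2 p3 p4 p5 : PermTree → PermTree) (x : PermTree) : PermTree → ℕ :=
  PermTree.rec (fun _ => 0) (fun a y => Nat.mul a (val y))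
    (fun _ _ _ _ _ _ h0 h1 h2 h3 h4 h5 y =>
      Nat.add (h0 (p0 y)) (Nat.add (h1 (p1 y)) (Nat.add (h2 (p2 y)) (Nat.add (h3 (p3 y))
        (Nat.add (h4 (p4 y)) (h5 (p5 y))))))) x

/-- `dot` for the correspondence of children given by `h`. -/
noncomputable def permDot (h : Fin 6 → Fin 6) : PermTree → PermTree → ℕ :=
  dot (child (h 0)) (child (h 1)) (child (h 2)) (child (h 3)) (child (h 4)) (child (h 5))

/-- Since `val` is `0` off the leaves, this holds for all trees; asking only for an inequality
avoids any hypothesis on their shape. -/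
theorem val_mul_val_le_permDot (h : Fin 6 → Fin 6) (x y : PermTree) :
    val x * val y ≤ permDot h x y := by
  cases x with
  | n => exact (Nat.zero_mul _).le
  | l a => exact le_rfl
  | b => exact (Nat.zero_mul _).le.trans (Nat.zero_le _)

theorem sum_permDot_child_le (h : Fin 6 → Fin 6) (x y : PermTree) :
    ∑ i, permDot h (child i x) (child (h i) y) ≤ permDot h x y := by
  cases x with
  | n =>
    refine (Finset.sum_eq_zero fun i _ => ?_).le
    fin_cases i <;> rfl
  | l a =>
    refine (Finset.sum_eq_zero fun i _ => ?_).le.trans (Nat.zero_le _)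
    fin_cases i <;> rfl
  | b x0 x1 x2 x3 x4 x5 =>
    refine le_of_eq ?_
    simp only [Fin.sum_univ_six, add_assoc]
    rfl

theorem sum_look_mul_look_le (h : Fin 6 → Fin 6) (x y : PermTree) :
    ∑ i, ∑ j, ∑ k, ∑ m, ∑ p, x.look i j k m p * y.look (h i) (h j) (h k) (h m) (h p) ≤
      permDot h x y := by
  refine (Finset.sum_le_sum fun i _ => ?_).trans (sum_permDot_child_le h x y)
  refine (Finset.sum_le_sum fun j _ => ?_).trans (sum_permDot_child_le h _ _)
  refine (Finset.sum_le_sum fun k _ => ?_).trans (sum_permDot_child_le h _ _)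
  refine (Finset.sum_le_sum fun m _ => ?_).trans (sum_permDot_child_le h _ _)
  refine (Finset.sum_le_sum fun p _ => ?_).trans (sum_permDot_child_le h _ _)
  exact val_mul_val_le_permDot h _ _

/-- Left multiplication by `h` acts on the values of `g`, hence on the labels of the branches, so
one simultaneous traversal of both trees computes the correlation. Permutations embed into 5-tuples
of values, and the extra tuples contribute natural numbers, which only enlarge the sum. -/
theorem sum_eval_mul_eval_le (h : Perm (Fin 6)) (x y : PermTree) :
    ∑ g, x.eval g * y.eval (h * g) ≤ permDot h x y := by
  refine le_trans ?_ (sum_look_mul_look_le h x y)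
  simp_rw [← Fintype.sum_prod_type']
  let F (t : Fin 6 × Fin 6 × Fin 6 × Fin 6 × Fin 6) : ℕ :=
    x.look t.1 t.2.1 t.2.2.1 t.2.2.2.1 t.2.2.2.2 *
    y.look (h t.1) (h t.2.1) (h t.2.2.1) (h t.2.2.2.1) (h t.2.2.2.2)
  let f (g : Perm (Fin 6)) : Fin 6 × Fin 6 × Fin 6 × Fin 6 × Fin 6 := (g 0, g 1, g 2, g 3, g 4)
  have hf : Function.Injective f := fun g g' hg => by
    simp only [f, Prod.mk.injEq] at hg
    obtain ⟨h0, h1, h2, h3, h4⟩ := hg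
    have hlt (i : Fin 6) (hi : i ≠ 5) : g i = g' i := by
      fin_cases i <;> first | assumption | exact absurd rfl hi
    ext i : 1
    rcases eq_or_ne i 5 with rfl | hi
    -- The last value is forced: `g'` must take the value `g 5` somewhere, and at any other place
    -- injectivity of `g` would fail.
    · obtain ⟨j, hj⟩ := g'.surjective (g 5)
      rcases eq_or_ne j 5 with rfl | hj5
      · exact hj.symm
      · exact absurd (g.injective ((hlt j hj5).trans hj)) hj5
    · exact hlt i hi
  calc ∑ g, x.eval g * y.eval (h * g) = ∑ t ∈ Finset.univ.image f, F t := by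
        rw [Finset.sum_image hf.injOn]
        rfl
    _ ≤ ∑ t, F t := Finset.sum_le_sum_of_subset (Finset.subset_univ _)

/-- The permutations of `Fin 6` as lists of values. -/
def perms : List (List (Fin 6)) :=
  [0, 1, 2, 3, 4, 5].permutations'

theorem mem_perms (h : Perm (Fin 6)) : [h 0, h 1, h 2, h 3, h 4, h 5] ∈ perms :=
  List.mem_permutations'.2 h.map_finRange_perm

/-- Replaces a sum over the group by a sum over an explicit list, which the kernel can evaluate. The
lists of values are distinct members of `perms`, and both sides have `6!` elements. -/
theorem sum_perms (F : List (Fin 6) → ℕ) :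
    (perms.map F).sum = ∑ h : Perm (Fin 6), F [h 0, h 1, h 2, h 3, h 4, h 5] := by
  have hnodup : perms.Nodup :=
    List.permutations_perm_permutations' _ |>.nodup_iff.1 (List.nodup_permutations _ (by decide))
  have hinj : Function.Injective
      fun h : Perm (Fin 6) => [h 0, h 1, h 2, h 3, h 4, h 5] := fun g h hgh => by
    simp only [List.cons.injEq] at hgh
    ext i : 1
    fin_cases i <;> simp [hgh]
  have himage : Finset.univ.image (fun h : Perm (Fin 6) => [h 0, h 1, h 2, h 3, h 4, h 5]) =
      perms.toFinset := by
    refine Finset.eq_of_subset_of_card_le (fun t ht => ?_) ?_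
    · obtain ⟨h, -, rfl⟩ := Finset.mem_image.1 ht
      exact List.mem_toFinset.2 (mem_perms h)
    · rw [Finset.card_image_of_injective _ hinj, List.toFinset_card_of_nodup hnodup,
        Finset.card_univ, Fintype.card_perm]
      exact ((List.permutations_perm_permutations' _).length_eq.symm.trans
        (List.length_permutations _)).le
  rw [← List.sum_toFinset _ hnodup, ← himage, Finset.sum_image hinj.injOn]

/-- The bound on the correlation of the weights, for one permutation. -/
noncomputable def correlationCheck : List (Fin 6) → Bool
  | [h0, h1, h2, h3, h4, h5] =>
    withChild h0 fun p0 => withChild h1 fun p1 => withChild h2 fun p2 => withChild h3 fun p3 =>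
    withChild h4 fun p4 => withChild h5 fun p5 =>
      -- The distance is looked up at `h * Fin.revPerm`, whose first five values are `h5, h4, h3,
      -- h2, h1`. The constants are `N = 10 ^ 10` and `T = 604405336041`.
      Nat.ble (dot p0 p1 p2 p3 p4 p5 weight weight)
        (10 ^ 10 * dist.look h5 h4 h3 h2 h1 + 604405336041)
  | _ => false

/-- Fixing the first two values splits the verification into kernel computations over at most `4! =
24` permutations each. -/
theorem all_correlationCheck (i j : Fin 6) :
    (perms.filter fun t => t.take 2 == [i, j]).all correlationCheck = true := by
  fin_cases i <;> fin_cases j <;> decide +kernel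

theorem sum_weight_mul_weight_le (h : Perm (Fin 6)) :
    ∑ g, weight.eval g * weight.eval (h * g) ≤
      10 ^ 10 * dist.eval (h * Fin.revPerm) + 604405336041 := by
  have hc := List.all_eq_true.1 (all_correlationCheck (h 0) (h 1)) _
    (List.mem_filter.2 ⟨mem_perms h, by simp⟩)
  simp only [correlationCheck, withChild_eq] at hc
  exact (sum_eval_mul_eval_le h weight weight).trans (Nat.le_of_ble_eq_true hc)

theorem sum_weight : ∑ h, weight.eval h = 21599973 := by
  let F : List (Fin 6) → ℕ := fun t => match t with
    | [h0, h1, h2, h3, h4, _] => weight.look h0 h1 h2 h3 h4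
    | _ => 0
  have h : (perms.map F).sum = 21599973 := by
    decide +kernel
  rwa [sum_perms] at h

/-- The Lipschitz condition for the distances, for one permutation. -/
noncomputable def distCheck : List (Fin 6) → Bool
  | [h0, h1, h2, h3, h4, h5] =>
    Nat.ble (dist.look h1 h2 h3 h4 h5) (dist.look h0 h1 h2 h3 h4 + 1) &&
    Nat.ble (dist.look h1 h0 h2 h3 h4) (dist.look h0 h1 h2 h3 h4 + 1) &&
    Nat.ble (dist.look h0 h2 h1 h3 h4) (dist.look h0 h1 h2 h3 h4 + 1) &&
    Nat.ble (dist.look h0 h1 h3 h2 h4) (dist.look h0 h1 h2 h3 h4 + 1) &&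
    Nat.ble (dist.look h0 h1 h2 h4 h3) (dist.look h0 h1 h2 h3 h4 + 1) &&
    Nat.ble (dist.look h0 h1 h2 h3 h5) (dist.look h0 h1 h2 h3 h4 + 1) &&
    Nat.ble (dist.look h5 h0 h1 h2 h3) (dist.look h0 h1 h2 h3 h4 + 1)
  | _ => false

theorem all_distCheck : perms.all distCheck = true := by
  decide +kernel

theorem dist_mul_interchangePerm_le (h : Perm (Fin 6)) (i : Fin 7) :
    dist.eval (h * CyclicOrdering.interchangePerm i) ≤ dist.eval h + 1 := by
  have hc := List.all_eq_true.1 all_distCheck _ (mem_perms h)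
  simp only [distCheck, Bool.and_eq_true, Nat.ble_eq] at hc
  obtain ⟨⟨⟨⟨⟨⟨c0, c1⟩, c2⟩, c3⟩, c4⟩, c5⟩, c6⟩ := hc
  fin_cases i
  -- The conjuncts of `distCheck` follow the order of `interchangePerm`, so each matches its goal by
  -- unfolding.
  exacts [c0, c1, c2, c3, c4, c5, c6]

theorem dist_one : dist.eval 1 = 0 := by
  decide +kernel

end PermTree

/-! ### Assembly of the bound -/

theorem CyclicOrdering.dist_le_interchangeDist (g h : Perm (Fin 6)) :
    PermTree.dist.eval (g⁻¹ * h * Fin.revPerm) ≤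
      (ofPerm g).interchangeDist (ofPerm h).reverse := by
  rw [reverse_ofPerm, mul_assoc]
  exact le_interchangeDist_ofPerm PermTree.dist_one PermTree.dist_mul_interchangePerm_le _ _

theorem mainTheorem3 :
    ∃ p : ℝ,
      IsLeast {v : ℝ | ∃ x : CyclicOrdering 7 → ℝ,
        (∀ ρ, 0 ≤ x ρ) ∧ ∑ ρ, x ρ = 1 ∧ v = x ⬝ᵥ (crossingMatrix 7 *ᵥ x)} p ∧
      4.3593 ≤ p := by
  have : Nonempty (CyclicOrdering 7) := ⟨CyclicOrdering.ofPerm 1⟩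
  obtain ⟨p, hp⟩ := exists_isLeast_dotProduct_mulVec (crossingMatrix 7)
  refine ⟨p, hp, ?_⟩
  obtain ⟨x, hx0, hx1, hpx⟩ := hp.1
  rw [hpx]
  have hbound := sq_sum_div_card_le_of_correlation_le
    (w := fun h : Perm (Fin 6) => (PermTree.weight.eval h : ℝ))
    (e := fun h => (PermTree.dist.eval (h * Fin.revPerm) : ℝ)) (N := 10 ^ 10) (T := 604405336041)
    (fun h => by exact_mod_cast PermTree.sum_weight_mul_weight_le h)
    (x := fun h => x (CyclicOrdering.permEquiv h)) (fun h => hx0 _)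
    (by rw [← hx1]; exact Equiv.sum_comp CyclicOrdering.permEquiv x)
  -- Nonnegativity of `x` lets the tabulated lower bounds replace the entries of `Q`.
  have hform : ∑ g, ∑ h, x (CyclicOrdering.permEquiv g) * x (CyclicOrdering.permEquiv h) *
      (PermTree.dist.eval (g⁻¹ * h * Fin.revPerm) : ℝ) ≤ x ⬝ᵥ (crossingMatrix 7 *ᵥ x) := by
    simp only [dotProduct, mulVec, Finset.mul_sum]
    rw [← Equiv.sum_comp CyclicOrdering.permEquiv]
    refine Finset.sum_le_sum fun g _ => ?_
    rw [← Equiv.sum_comp CyclicOrdering.permEquiv]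
    refine Finset.sum_le_sum fun h _ => ?_
    have hd : (PermTree.dist.eval (g⁻¹ * h * Fin.revPerm) : ℝ) ≤
        crossingMatrix 7 (CyclicOrdering.permEquiv g) (CyclicOrdering.permEquiv h) :=
      Nat.cast_le.2 (CyclicOrdering.dist_le_interchangeDist g h)
    calc _ ≤ x (CyclicOrdering.permEquiv g) * x (CyclicOrdering.permEquiv h) *
          crossingMatrix 7 (CyclicOrdering.permEquiv g) (CyclicOrdering.permEquiv h) :=
          mul_le_mul_of_nonneg_left hd (mul_nonneg (hx0 _) (hx0 _))
      _ = _ := by ring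
  have hsum : ∑ h, (PermTree.weight.eval h : ℝ) = 21599973 := by
    exact_mod_cast PermTree.sum_weight
  have hcard : (Fintype.card (Perm (Fin 6)) : ℝ) = 720 := by
    rw [Fintype.card_perm, Fintype.card_fin]
    norm_num [Nat.factorial]
  rw [hsum, hcard] at hbound
  -- Numerically, `(21599973 ^ 2 / 720 - 604405336041) / 10 ^ 10 ≈ 4.359304`, just above the claimed
  -- bound.
  norm_num at hbound ⊢
  linarith
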